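/- Let $\mathbb K=\mathbb R$ or $\mathbb C$. A Köthe space on $\mathbb N$ is a Banach space $X$ of sequences in $\mathbb K$ that contains all finitely supported $0$-$1$ sequences and is solid: if $|f(n)|\le|g(n)|$ for all $n$ and $g\in X$, then $f\in X$ and $\|f\|\le\|g\|$. Its Köthe dual $X'$ consists of the sequences $g$ with $\sum_n|g(n)f(n)|<\infty$ for all $f\in X$, normed as functionals $f\mapsto\sum_n g(n)f(n)$ on $X$; $X''=(X')'$, with $\|h\|_{X''}=\sup\{|\sum_n h(n)g(n)| : g\in X',\ \|g\|_{X'}\le1\}$. The Köthe space $X$ is a rearrangement invariant (r.i.) space on $\mathbb N$ if (1) for every bijection $\tau$ of $\mathbb N$ and every $f\in\ell_1$, $f\in X$ if and only if $f\circ\tau^{-1}\in X$, and then $\|f\|=\|f\circ\tau^{-1}\|$ (by (2), this then holds for every sequence $f$); (2) $X'$ is norming for $X$, i.e. $\|x\|=\|x\|_{X''}$ for all $x\in X$, and either $X=X''$ or $X$ is the closed linear span in $X''$ of the finitely supported sequences; (3) $\ell_1\subset X\subset\ell_\infty$, with $\|f\|_X\le\|f\|_1$ for $f\in\ell_1$ and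 $\|f\|_\infty\le\|f\|_X$ for $f\in X$. For a Banach space $X$ with closed unit ball $B_X$, unit sphere $S_X$, $x^*\in S_{X^*}$ and $\varepsilon>0$, let $S(B_X,x^*,\varepsilon)=\{x\in B_X:\operatorname{Re}x^*(x)>1-\varepsilon\}$. The space $X$ is lush if for all $x,y\in S_X$ and $\varepsilon>0$ there is $x^*\in S_{X^*}$ such that $x\in S:=S(B_X,x^*,\varepsilon)$ and $\operatorname{dist}(y,\overline{\mathrm{aconv}}(S))<\varepsilon$, where $\overline{\mathrm{aconv}}(S)$ is the closed convex hull of $\{\theta s:|\theta|=1,\ s\in S\}$. **Theorem.** Let $X$ be a separable r.i. space on $\mathbb N$ over $\mathbb K$. If $X$ is lush, then $X=c_0$ or $X=\ell_1$ isometrically, that is, either $X$ and $c_0$ are the same space of sequences and $\|x\|=\sup_n|x(n)|$ for all $x\in X$, or $X$ and $\ell_1$ are the same space of sequences and $\|x\|=\sum_n|x(n)|$ for all $x\in X$. -/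

import Mathlib

open scoped ENNReal ZeroAtInfty

section Lush

variable (𝕜 : Type*) [RCLike 𝕜] {E : Type*} [NormedAddCommGroup E] [NormedSpace 𝕜 E]

/-- The closed absolutely convex hull of `A`: the closed (real) convex hull of `𝕋 A`, where
`𝕋` is the set of scalars of modulus one. -/
def closedAconv (A : Set E) : Set E :=
  letI : NormedSpace ℝ E := NormedSpace.restrictScalars ℝ 𝕜 E
  closure (convexHull ℝ {z : E | ∃ θ : 𝕜, ‖θ‖ = 1 ∧ ∃ a ∈ A, z = θ • a})

variable {𝕜}

/-- The slice `S(B, φ, α) = {x ∈ B : Re φ(x) > sup Re φ(B) - α}`. -/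
def slice (B : Set E) (φ : E →L[𝕜] 𝕜) (α : ℝ) : Set E :=
  {x ∈ B | sSup ((fun z => RCLike.re (φ z)) '' B) - α < RCLike.re (φ x)}

variable (𝕜 E)

/-- Lushness: for all `x, y` in the unit sphere and all `ε > 0` there is a norm-one functional
`φ` such that `x` lies in the slice `S = S(B_E, φ, ε)` and the distance from `y` to the closed
absolutely convex hull of `S` is less than `ε`. -/
def IsLush : Prop :=
  ∀ x y : E, ‖x‖ = 1 → ‖y‖ = 1 → ∀ ε : ℝ, 0 < ε →
    ∃ φ : E →L[𝕜] 𝕜, ‖φ‖ = 1 ∧ x ∈ slice (Metric.closedBall (0 : E) 1) φ ε ∧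
      Metric.infDist y (closedAconv 𝕜 (slice (Metric.closedBall (0 : E) 1) φ ε)) < ε

end Lush

section SequenceSpaces

variable {𝕜 : Type*} [RCLike 𝕜] {X : Type*} [NormedAddCommGroup X] [NormedSpace 𝕜 X]

/-- A normed space of scalar sequences is given by the space `X` and the linear inclusion map
`coord : X → 𝕜^ℕ`; a sequence belongs to `X` when it lies in `LinearMap.range coord`.
A Banach space of sequences is a Köthe space over `ℕ` with counting measure if it is solid and
contains the indicators of all sets of finite measure. -/
structure IsKothe (coord : X →ₗ[𝕜] (ℕ → 𝕜)) : Prop where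
  injective : Function.Injective coord
  solid : ∀ (f : ℕ → 𝕜) (g : X), (∀ n, ‖f n‖ ≤ ‖coord g n‖) → ∃ x : X, coord x = f ∧ ‖x‖ ≤ ‖g‖
  indicator_mem : ∀ A : Set ℕ, A.Finite →
    A.indicator (fun _ => (1 : 𝕜)) ∈ LinearMap.range coord

/-- The Köthe dual `X'`: the sequences `g` with `g f ∈ ℓ₁` for every `f ∈ X`. -/
def kotheDual (coord : X →ₗ[𝕜] (ℕ → 𝕜)) : Set (ℕ → 𝕜) :=
  {g | ∀ f : X, Summable fun n => ‖g n * coord f n‖}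

/-- The norm on `X'` induced by `X*`, that is, the norm of the functional
`f ↦ ∑ g(n) f(n)`. -/
noncomputable def kotheDualNorm (coord : X →ₗ[𝕜] (ℕ → 𝕜)) (g : ℕ → 𝕜) : ℝ≥0∞ :=
  ⨆ (f : X) (_ : ‖f‖ ≤ 1), ‖∑' n, g n * coord f n‖ₑ

/-- The second Köthe dual `X'' = (X')'`. -/
def kotheBidual (coord : X →ₗ[𝕜] (ℕ → 𝕜)) : Set (ℕ → 𝕜) :=
  {h | ∀ g ∈ kotheDual coord, Summable fun n => ‖h n * g n‖}

/-- The norm of `X''`, that is, the norm of the functional `g ↦ ∑ h(n) g(n)` on `X'`. -/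
noncomputable def kotheBidualNorm (coord : X →ₗ[𝕜] (ℕ → 𝕜)) (h : ℕ → 𝕜) : ℝ≥0∞ :=
  ⨆ (g : ℕ → 𝕜) (_ : g ∈ kotheDual coord) (_ : kotheDualNorm coord g ≤ 1),
    ‖∑' n, h n * g n‖ₑ

/-- The closure in `X''` of the finitely supported sequences (which are the simple integrable
functions on `ℕ`). -/
def closedSpanSimple (coord : X →ₗ[𝕜] (ℕ → 𝕜)) : Set (ℕ → 𝕜) :=
  {h ∈ kotheBidual coord | ∀ ε : ℝ≥0∞, 0 < ε →
    ∃ s : ℕ → 𝕜, (Function.support s).Finite ∧ kotheBidualNorm coord (h - s) < ε}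

/-- Rearrangement invariant spaces on `ℕ`. -/
structure IsRearrangementInvariant (coord : X →ₗ[𝕜] (ℕ → 𝕜)) : Prop extends IsKothe coord where
  /-- Invariance under permutations, for integrable functions on `ℕ`. -/
  perm : ∀ (τ : Equiv.Perm ℕ) (f : ℕ → 𝕜), Summable (fun n => ‖f n‖) →
    (f ∈ LinearMap.range coord ↔ f ∘ τ.symm ∈ LinearMap.range coord) ∧
      ∀ x y : X, coord x = f → coord y = f ∘ τ.symm → ‖x‖ = ‖y‖
  /-- `X'` is norming for `X`, i.e. `X` embeds isometrically into `X''`. -/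
  norming : ∀ x : X, ‖x‖ₑ = kotheBidualNorm coord (coord x)
  /-- `X = X''`, or `X` is the closed linear span of the simple integrable functions in `X''`. -/
  range_eq : (LinearMap.range coord : Set (ℕ → 𝕜)) = kotheBidual coord ∨
    (LinearMap.range coord : Set (ℕ → 𝕜)) = closedSpanSimple coord
  /-- `ℓ₁ ⊆ X`, with inclusion of norm at most one. -/
  ell_one_le : ∀ f : ℕ → 𝕜, Summable (fun n => ‖f n‖) →
    ∃ x : X, coord x = f ∧ ‖x‖ ≤ ∑' n, ‖f n‖
  /-- `X ⊆ ℓ_∞`, with inclusion of norm at most one. -/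
  le_ell_infty : ∀ (x : X) (n : ℕ), ‖coord x n‖ ≤ ‖x‖

end SequenceSpaces

/-! ### Lushness tested against functionals. -/

section LushFunctionals

variable {𝕜 : Type*} [RCLike 𝕜] {X : Type*} [NormedAddCommGroup X] [NormedSpace 𝕜 X]

/-! Lushness enters through `IsLush.exists_functional`. Its `φ` is chosen before `ψ`, so `ψ` may be
built from `φ`: take a vector on which `φ` is large, flip the sign of one coordinate, and test with
`φ` carrying the same flip. The resulting `t` makes both |p + q| and |p - q| nearly 1, where p and q
are the contributions of that coordinate and of the others to `φ t`. As |p| + |q| ≤ 1, the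
parallelogram law leaves only |p| ≈ 0 or |q| ≈ 0.

Used once, this gives almost norming functionals with |φ(e_k)| near 0 or 1, so the norm as a
function of one coordinate has slope 0 or 1. Raising the coordinates of an indicator one at a time
shows that the fundamental function F(n) = ‖1_{[0,n)}‖ satisfies F(n+1) = F(n) or F(n+1) = n+1. Used
again, it excludes F(n) = F(n+1) = n for n ≥ 2. Hence F(n) = n for all n, or F ≤ 1. In the first
case the triangle inequality forces the ℓ₁ norm; in the second the norm is the sup norm,
separability makes all elements null sequences, and completeness supplies every null sequence. -/

/-- Every scalar can be rotated onto the nonnegative real axis. -/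
theorem exists_norm_one_mul_eq_norm (z : 𝕜) : ∃ θ : 𝕜, ‖θ‖ = 1 ∧ θ * z = (‖z‖ : 𝕜) := by
  obtain ⟨c, hc, h⟩ := RCLike.exists_norm_eq_mul_self z
  exact ⟨c, hc, h.symm⟩

/-- Slices are cut relative to the supremum of `Re φ` over the ball; this turns membership into a
lower bound in terms of ‖φ‖. -/
theorem norm_le_sSup_re_closedBall (φ : X →L[𝕜] 𝕜) :
    ‖φ‖ ≤ sSup ((fun z => RCLike.re (φ z)) '' Metric.closedBall (0 : X) 1) := by
  have hbdd : BddAbove ((fun z => RCLike.re (φ z)) '' Metric.closedBall (0 : X) 1) := by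
    refine ⟨‖φ‖, ?_⟩
    rintro _ ⟨z, hz, rfl⟩
    have hz' : ‖z‖ ≤ 1 := by simpa using hz
    exact (RCLike.re_le_norm _).trans (φ.unit_le_opNorm z hz')
  rw [← φ.sSup_unitClosedBall_eq_norm]
  refine csSup_le ((Metric.nonempty_closedBall.2 zero_le_one).image _) ?_
  rintro _ ⟨z, hz, rfl⟩
  obtain ⟨θ, hθ, h⟩ := exists_norm_one_mul_eq_norm (φ z)
  refine le_csSup hbdd ⟨θ • z, ?_, ?_⟩
  · simpa [norm_smul, hθ] using hz
  · simp [h]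

/-- The real part of a functional on the closed absolutely convex hull is controlled by its values
on rotations of the generating set. -/
theorem re_le_of_mem_closedAconv {A : Set X} {ψ : X →L[𝕜] 𝕜} {M : ℝ}
    (h : ∀ θ : 𝕜, ‖θ‖ = 1 → ∀ a ∈ A, RCLike.re (ψ (θ • a)) ≤ M) {z : X}
    (hz : z ∈ closedAconv 𝕜 A) : RCLike.re (ψ z) ≤ M := by
  let : NormedSpace ℝ X := NormedSpace.restrictScalars ℝ 𝕜 X
  have : IsScalarTower ℝ 𝕜 X := IsScalarTower.of_algebraMap_smul fun _ _ => rfl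
  have hclosed : IsClosed {z : X | RCLike.re (ψ z) ≤ M} :=
    isClosed_le (RCLike.continuous_re.comp ψ.continuous) continuous_const
  have hconvex : Convex ℝ {z : X | RCLike.re (ψ z) ≤ M} := by
    refine convex_halfSpace_le (f := fun z => RCLike.re (ψ z)) ⟨fun a b => ?_, fun c a => ?_⟩ M
    · simp
    · rw [← algebraMap_smul 𝕜 c a, map_smul]
      simp
  refine closure_minimal (convexHull_min ?_ hconvex) hclosed hz
  rintro _ ⟨θ, hθ, a, ha, rfl⟩
  exact h θ hθ a ha

/-- In a lush space, one norm-one functional `φ` almost norms `x`, and every functional `ψ` has an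
almost `φ`-norming vector at which its value is almost as large as at `y`. -/
theorem IsLush.exists_functional (hlush : IsLush 𝕜 X) {x y : X} (hx : ‖x‖ = 1) (hy : ‖y‖ = 1)
    {δ : ℝ} (hδ : 0 < δ) :
    ∃ φ : X →L[𝕜] 𝕜, ‖φ‖ = 1 ∧ 1 - δ < RCLike.re (φ x) ∧ ∀ ψ : X →L[𝕜] 𝕜, ∃ t : X, ‖t‖ ≤ 1 ∧
      1 - δ < ‖φ t‖ ∧ RCLike.re (ψ y) - δ * (‖ψ‖ + 1) ≤ RCLike.re (ψ t) := by
  obtain ⟨φ, hφ, ⟨hxB, hxφ⟩, hdist⟩ := hlush x y hx hy δ hδ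
  have hsup := norm_le_sSup_re_closedBall φ
  rw [hφ] at hsup
  refine ⟨φ, hφ, by linarith, fun ψ => ?_⟩
  by_contra! hcon
  have hxmem : x ∈ closedAconv 𝕜 (slice (Metric.closedBall (0 : X) 1) φ δ) :=
    let : NormedSpace ℝ X := NormedSpace.restrictScalars ℝ 𝕜 X
    subset_closure (subset_convexHull ℝ _ ⟨1, by simp, x, ⟨hxB, hxφ⟩, by simp⟩)
  obtain ⟨z, hz, hyz⟩ := (Metric.infDist_lt_iff ⟨x, hxmem⟩).1 hdist
  have hzle : RCLike.re (ψ z) ≤ RCLike.re (ψ y) - δ * (‖ψ‖ + 1) := by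
    refine re_le_of_mem_closedAconv (fun θ hθ a ha => ?_) hz
    refine (hcon (θ • a) ?_ ?_).le
    · simpa [norm_smul, hθ] using ha.1
    · rw [map_smul, norm_smul, hθ, one_mul]
      exact (by linarith [ha.2] : 1 - δ < RCLike.re (φ a)).trans_le (RCLike.re_le_norm _)
  -- The `+ 1` in the error term is the slack: moving from `y` to `z` costs at most ‖ψ‖δ, while
  -- `hzle` claims a drop of ‖ψ‖δ + δ.
  have h1 : RCLike.re (ψ y) - RCLike.re (ψ z) ≤ ‖ψ‖ * δ := by
    rw [← map_sub, ← map_sub]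
    refine (RCLike.re_le_norm _).trans ((ψ.le_opNorm _).trans ?_)
    rw [← dist_eq_norm]
    gcongr
  linarith

end LushFunctionals

/-! ### Unit vectors, coordinate functionals and coordinate erasure. -/

section KotheLattice

variable {𝕜 : Type*} [RCLike 𝕜] {X : Type*} [NormedAddCommGroup X] [NormedSpace 𝕜 X]
  {coord : X →ₗ[𝕜] (ℕ → 𝕜)}

theorem IsKothe.norm_le_norm (h : IsKothe coord) {x y : X}
    (hxy : ∀ n, ‖coord x n‖ ≤ ‖coord y n‖) : ‖x‖ ≤ ‖y‖ := by
  obtain ⟨z, hz, hzy⟩ := h.solid (coord x) y hxy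
  rwa [← h.injective hz]

theorem IsKothe.norm_eq_norm (h : IsKothe coord) {x y : X}
    (hxy : ∀ n, ‖coord x n‖ = ‖coord y n‖) : ‖x‖ = ‖y‖ :=
  le_antisymm (h.norm_le_norm fun n => (hxy n).le) (h.norm_le_norm fun n => (hxy n).ge)

theorem IsKothe.exists_coord_eq_single (h : IsKothe coord) (k : ℕ) :
    ∃ x : X, coord x = Pi.single k 1 := by
  obtain ⟨x, hx⟩ := h.indicator_mem {k} (Set.finite_singleton k)
  refine ⟨x, hx.trans ?_⟩
  ext n
  by_cases hn : n = k
  · subst hn; simp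
  · simp [hn]

/-- The unit vectors of a Köthe space on `ℕ`. -/
noncomputable def IsKothe.unitVec (h : IsKothe coord) (k : ℕ) : X :=
  (h.exists_coord_eq_single k).choose

theorem IsKothe.coord_unitVec (h : IsKothe coord) (k : ℕ) :
    coord (h.unitVec k) = Pi.single k 1 :=
  (h.exists_coord_eq_single k).choose_spec

theorem IsKothe.coord_unitVec_apply (h : IsKothe coord) (k n : ℕ) :
    coord (h.unitVec k) n = if n = k then 1 else 0 := by
  rw [h.coord_unitVec, Pi.single_apply]

theorem IsRearrangementInvariant.norm_unitVec (hX : IsRearrangementInvariant coord) (k : ℕ) :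
    ‖hX.unitVec k‖ = 1 := by
  refine le_antisymm ?_ ?_
  · have hs : HasSum (fun n => ‖(Pi.single k 1 : ℕ → 𝕜) n‖) 1 := by
      convert hasSum_ite_eq k (1 : ℝ) using 2 with n
      rw [Pi.single_apply]
      split_ifs <;> simp
    obtain ⟨x, hx, hxle⟩ := hX.ell_one_le _ hs.summable
    rw [hs.tsum_eq] at hxle
    rwa [hX.injective ((hX.coord_unitVec k).trans hx.symm)]
  · simpa [hX.coord_unitVec_apply] using hX.le_ell_infty (hX.unitVec k) k

/-- The coordinate functionals. -/
noncomputable def IsRearrangementInvariant.coordL (hX : IsRearrangementInvariant coord) (k : ℕ) :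
    X →L[𝕜] 𝕜 :=
  LinearMap.mkContinuous ((LinearMap.proj k).comp coord) 1 fun x => by
    simpa using hX.le_ell_infty x k

@[simp]
theorem IsRearrangementInvariant.coordL_apply (hX : IsRearrangementInvariant coord) (k : ℕ)
    (x : X) : hX.coordL k x = coord x k := rfl

theorem IsRearrangementInvariant.norm_coordL_le (hX : IsRearrangementInvariant coord) (k : ℕ) :
    ‖hX.coordL k‖ ≤ 1 :=
  LinearMap.mkContinuous_norm_le _ zero_le_one _

/-- The projection that replaces the `k`-th coordinate by zero. -/
noncomputable def IsRearrangementInvariant.eraseL (hX : IsRearrangementInvariant coord) (k : ℕ) :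
    X →L[𝕜] X :=
  ContinuousLinearMap.id 𝕜 X - (hX.coordL k).smulRight (hX.unitVec k)

theorem IsRearrangementInvariant.eraseL_apply (hX : IsRearrangementInvariant coord) (k : ℕ)
    (x : X) : hX.eraseL k x = x - coord x k • hX.unitVec k := rfl

theorem IsRearrangementInvariant.coord_eraseL (hX : IsRearrangementInvariant coord) (k : ℕ)
    (x : X) (n : ℕ) : coord (hX.eraseL k x) n = if n = k then 0 else coord x n := by
  rw [hX.eraseL_apply, map_sub, map_smul]
  by_cases hn : n = k
  · subst hn; simp [hX.coord_unitVec_apply]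
  · simp [hX.coord_unitVec_apply, hn]

theorem IsRearrangementInvariant.norm_eraseL_apply_le (hX : IsRearrangementInvariant coord)
    (k : ℕ) (x : X) : ‖hX.eraseL k x‖ ≤ ‖x‖ := by
  refine hX.norm_le_norm fun n => ?_
  rw [hX.coord_eraseL]
  split_ifs <;> simp

theorem IsRearrangementInvariant.norm_eraseL_le (hX : IsRearrangementInvariant coord) (k : ℕ) :
    ‖hX.eraseL k‖ ≤ 1 :=
  ContinuousLinearMap.opNorm_le_bound _ zero_le_one fun x => by
    simpa using hX.norm_eraseL_apply_le k x

theorem IsRearrangementInvariant.apply_eq_add_eraseL (hX : IsRearrangementInvariant coord)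
    (φ : X →L[𝕜] 𝕜) (k : ℕ) (x : X) :
    φ x = coord x k * φ (hX.unitVec k) + φ (hX.eraseL k x) := by
  rw [hX.eraseL_apply, map_sub, map_smul, smul_eq_mul]
  ring

/-- Rotating the `k`-th coordinate and the remaining part independently does not increase any
coordinate modulus, so both contributions to `φ` can be made nonnegative at no cost in norm. -/
theorem IsRearrangementInvariant.norm_apply_add_norm_apply_le
    (hX : IsRearrangementInvariant coord) {φ : X →L[𝕜] 𝕜} (hφ : ‖φ‖ ≤ 1) (k : ℕ) (x : X) :
    ‖φ (hX.unitVec k)‖ * ‖coord x k‖ + ‖φ (hX.eraseL k x)‖ ≤ ‖x‖ := by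
  obtain ⟨α, hα, h1⟩ := exists_norm_one_mul_eq_norm (φ (hX.unitVec k))
  obtain ⟨β, hβ, h2⟩ := exists_norm_one_mul_eq_norm (φ (hX.eraseL k x))
  have hnorm : ‖((‖coord x k‖ : 𝕜) * α) • hX.unitVec k + β • hX.eraseL k x‖ ≤ ‖x‖ := by
    refine hX.norm_le_norm fun n => ?_
    rw [map_add, map_smul, map_smul]
    by_cases hn : n = k
    · subst hn; simp [hX.coord_unitVec_apply, hX.coord_eraseL, hα]
    · simp [hX.coord_unitVec_apply, hX.coord_eraseL, hβ, hn]
  have hval : φ (((‖coord x k‖ : 𝕜) * α) • hX.unitVec k + β • hX.eraseL k x) =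
      ((‖φ (hX.unitVec k)‖ * ‖coord x k‖ + ‖φ (hX.eraseL k x)‖ : ℝ) : 𝕜) := by
    rw [map_add, map_smul, map_smul, smul_eq_mul, smul_eq_mul, h2, mul_assoc, h1]
    push_cast
    ring
  have := (φ.le_of_opNorm_le hφ _).trans ((one_mul _).trans_le hnorm)
  rw [hval, RCLike.norm_ofReal, abs_of_nonneg (by positivity)] at this
  exact this

end KotheLattice

/-! ### Almost norming functionals with an extreme coefficient. -/

section Dichotomy

variable {𝕜 : Type*} [RCLike 𝕜] {X : Type*} [NormedAddCommGroup X] [NormedSpace 𝕜 X]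
  {coord : X →ₗ[𝕜] (ℕ → 𝕜)}

/-- `IsLush.exists_functional` without normalization of `x` and `y`. -/
theorem IsLush.exists_functional_of_ne_zero (hlush : IsLush 𝕜 X) {x y : X} (hx : x ≠ 0)
    (hy : y ≠ 0) {δ : ℝ} (hδ : 0 < δ) :
    ∃ φ : X →L[𝕜] 𝕜, ‖φ‖ = 1 ∧ (1 - δ) * ‖x‖ < RCLike.re (φ x) ∧
      ∀ ψ : X →L[𝕜] 𝕜, ∃ t : X, ‖t‖ ≤ 1 ∧ 1 - δ < ‖φ t‖ ∧
        RCLike.re (ψ y) - δ * (‖ψ‖ + 1) * ‖y‖ ≤ ‖y‖ * RCLike.re (ψ t) := by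
  have key : ∀ (χ : X →L[𝕜] 𝕜) (z : X),
      RCLike.re (χ (((‖z‖⁻¹ : ℝ) : 𝕜) • z)) = ‖z‖⁻¹ * RCLike.re (χ z) := fun χ z => by
    rw [map_smul, smul_eq_mul, RCLike.re_ofReal_mul]
  have hunit : ∀ z : X, z ≠ 0 → ‖((‖z‖⁻¹ : ℝ) : 𝕜) • z‖ = 1 := fun z hz => by
    rw [norm_smul, RCLike.norm_ofReal, abs_of_nonneg (by positivity),
      inv_mul_cancel₀ (norm_ne_zero_iff.2 hz)]
  obtain ⟨φ, hφ, hφx, h⟩ := hlush.exists_functional (hunit x hx) (hunit y hy) hδ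
  refine ⟨φ, hφ, ?_, fun ψ => ?_⟩
  · rwa [key, ← div_eq_inv_mul, lt_div_iff₀ (norm_pos_iff.2 hx)] at hφx
  · obtain ⟨t, ht, hφt, hψ⟩ := h ψ
    refine ⟨t, ht, hφt, ?_⟩
    rw [key] at hψ
    have := mul_le_mul_of_nonneg_left hψ (norm_nonneg y)
    rw [mul_sub, mul_inv_cancel_left₀ (norm_ne_zero_iff.2 hy)] at this
    linarith

/-- A quantitative form of the fact that `|p| = a`, `|q| = 1 - a`, `|p + q| = |p - q| = 1` force
`a = 0` or `a = 1`. -/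
theorem false_of_parallelogram {a r ρ R P N S D ε δ η : ℝ} (hε : 0 < ε) (hε' : ε ≤ 1 / 2)
    (hδ : δ = ε ^ 3 / 1000) (hη : η = 13 * ε ^ 2 / 1000) (ha : ε ≤ a) (ha' : a ≤ 1 - ε)
    (hr : r ≤ 1) (hρ : ρ ≤ r) (hN : a * r + N ≤ 1) (hR : R ≤ N) (hN0 : 0 ≤ N)
    (hP0 : 0 ≤ P) (hP : P ≤ a) (h : 2 - a - η ≤ ρ + R) (hD : a * ρ + R ≤ D) (hS : 1 - δ ≤ S)
    (hpar : S * S + D * D = 2 * (P * P + N * N)) : False := by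
  have hδ1 : δ ≤ ε / 1000 := by
    have : ε ^ 3 ≤ ε := by
      nlinarith [mul_nonneg hε.le (mul_nonneg hε.le (by linarith : (0:ℝ) ≤ 1 - ε)),
        mul_nonneg hε.le (by linarith : (0:ℝ) ≤ 1 - ε)]
    linarith
  have hη0 : 0 ≤ η := by rw [hη]; positivity
  have hη1 : η ≤ 7 * ε / 1000 := by nlinarith
  -- The hypotheses give (1 - a)(1 - r) ≤ η, and 1 - a ≥ ε; one factor ε is lost here.
  have hr1 : 1 - r ≤ 13 * ε / 1000 := by
    by_contra! hlt
    have h1 : ε * (1 - r) ≤ (1 - a) * (1 - r) := by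
      apply mul_le_mul_of_nonneg_right <;> linarith
    have h2 : (1 - a) * (1 - r) ≤ η := by nlinarith
    have h3 : ε * (13 * ε / 1000) < ε * (1 - r) := mul_lt_mul_of_pos_left hlt hε
    nlinarith
  have har : a - 13 * ε / 1000 ≤ a * r := by
    have := mul_le_mul_of_nonneg_right (by linarith : a ≤ 1) (by linarith : 0 ≤ 1 - r)
    linarith
  have hN1 : N ≤ 1 - a + 13 * ε / 1000 := by linarith
  have hρ1 : 1 - 20 * ε / 1000 ≤ ρ := by linarith
  have hR1 : 1 - a - 7 * ε / 1000 ≤ R := by linarith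
  have hD1 : 1 - 27 * ε / 1000 ≤ D := by
    have := mul_le_mul_of_nonneg_left hρ1 (by linarith : 0 ≤ a)
    have := mul_le_mul_of_nonneg_right (by linarith : a ≤ 1) (by linarith : 0 ≤ 20 * ε / 1000)
    linarith
  have hS2 := mul_self_le_mul_self (by linarith : 0 ≤ 1 - ε / 1000) (by linarith : 1 - ε / 1000 ≤ S)
  have hD2 := mul_self_le_mul_self (by linarith : 0 ≤ 1 - 27 * ε / 1000) hD1
  have hP2 := mul_self_le_mul_self hP0 hP
  have hN2 := mul_self_le_mul_self hN0 hN1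
  -- This is a(1 - a) ≥ ε(1 - ε) ≥ ε/2, so 2(a² + (1 - a)²) falls below 2 by at least 2ε, beyond all
  -- error terms.
  have haa := mul_nonneg (by linarith : 0 ≤ a - ε) (by linarith : 0 ≤ 1 - ε - a)
  have hεε : ε * ε ≤ ε * (1 / 2) := mul_le_mul_of_nonneg_left hε' hε.le
  have haε : 0 ≤ a * ε := mul_nonneg (by linarith) hε.le
  linarith [mul_self_nonneg ε]

/-- In a lush rearrangement invariant space, the functionals that almost attain their norm at `x`
include one whose `k`-th coefficient has modulus almost zero or almost one. -/
theorem IsRearrangementInvariant.exists_functional_dichotomy (hX : IsRearrangementInvariant coord)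
    (hlush : IsLush 𝕜 X) {x : X} (hx : ‖x‖ = 1) (k : ℕ) {ε : ℝ} (hε : 0 < ε) (hε' : ε ≤ 1 / 2) :
    ∃ φ : X →L[𝕜] 𝕜, ‖φ‖ = 1 ∧ 1 - ε ≤ RCLike.re (φ x) ∧
      (‖φ (hX.unitVec k)‖ ≤ ε ∨ 1 - ε ≤ ‖φ (hX.unitVec k)‖) := by
  -- Cubic because the argument divides errors by `a` and then by `1 - a`, both at least ε.
  obtain ⟨δ, hδ⟩ : ∃ δ : ℝ, δ = ε ^ 3 / 1000 := ⟨_, rfl⟩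
  have hδ0 : 0 < δ := by rw [hδ]; positivity
  have hδ1 : δ ≤ ε / 1000 := by
    have : ε ^ 3 ≤ ε := by
      nlinarith [mul_nonneg hε.le (mul_nonneg hε.le (by linarith : (0:ℝ) ≤ 1 - ε)),
        mul_nonneg hε.le (by linarith : (0:ℝ) ≤ 1 - ε)]
    linarith
  have hδ2 : δ ≤ ε ^ 2 / 1000 := by
    rw [hδ, pow_succ]
    nlinarith [sq_nonneg ε]
  set e := hX.unitVec k with he
  set Q := hX.eraseL k with hQ
  have hsplit : ∀ (χ : X →L[𝕜] 𝕜) (z : X), χ z = coord z k * χ e + χ (Q z) :=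
    fun χ z => hX.apply_eq_add_eraseL χ k z
  have hcoorde : coord e k = 1 := by simp [he, hX.coord_unitVec_apply]
  obtain ⟨s, hs, hsk, φ₁, hφ₁, hφ₁x, hφ₁s⟩ : ∃ s : X, ‖s‖ ≤ 1 ∧ 1 - 2 * δ ≤ ‖coord s k‖ ∧
      ∃ φ₁ : X →L[𝕜] 𝕜, ‖φ₁‖ = 1 ∧ 1 - δ < RCLike.re (φ₁ x) ∧ 1 - δ < RCLike.re (φ₁ s) := by
    obtain ⟨φ₁, hφ₁, hφ₁x, h₁⟩ := hlush.exists_functional hx (hX.norm_unitVec k) hδ0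
    obtain ⟨t, ht, hφ₁t, htk⟩ := h₁ (hX.coordL k)
    obtain ⟨θ, hθ, hθt⟩ := exists_norm_one_mul_eq_norm (φ₁ t)
    refine ⟨θ • t, by simpa [norm_smul, hθ] using ht, ?_, φ₁, hφ₁, hφ₁x, ?_⟩
    · rw [hX.coordL_apply, hX.coordL_apply, ← he, hcoorde, RCLike.one_re] at htk
      rw [map_smul, Pi.smul_apply, norm_smul, hθ, one_mul]
      have h2 := RCLike.re_le_norm (coord t k)
      have h3 := mul_le_mul_of_nonneg_left (hX.norm_coordL_le k) hδ0.le
      linarith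
    · rwa [map_smul, smul_eq_mul, hθt, RCLike.ofReal_re]
  have hsn : 1 - δ < ‖s‖ := hφ₁s.trans_le ((RCLike.re_le_norm _).trans
    ((φ₁.le_of_opNorm_le hφ₁.le s).trans_eq (one_mul _)))
  have hxsn : 2 - 2 * δ < ‖x + s‖ := by
    have h := (RCLike.re_le_norm _).trans
      ((φ₁.le_of_opNorm_le hφ₁.le (x + s)).trans_eq (one_mul _))
    rw [map_add, map_add] at h
    linarith
  -- `s` is almost aligned with `x` and has |s_k| ≈ 1; `s'` is `s` with its `k`-th coordinate
  -- negated.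
  obtain ⟨s', hs'⟩ : ∃ s' : X, s' = s - (2 * coord s k) • e := ⟨_, rfl⟩
  have hs'k : coord s' k = -coord s k := by
    rw [hs', map_sub, map_smul, Pi.sub_apply, Pi.smul_apply, hcoorde, smul_eq_mul]
    ring
  have hs'n : ∀ n, n ≠ k → coord s' n = coord s n := fun n hn => by
    simp [hs', he, hX.coord_unitVec_apply, hn]
  have hQs' : Q s' = Q s := by
    refine hX.injective (funext fun n => ?_)
    rw [hQ, hX.coord_eraseL, hX.coord_eraseL]
    split_ifs with hn
    · rfl
    · exact hs'n n hn
  have hs'norm : ‖s'‖ = ‖s‖ := by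
    refine hX.norm_eq_norm fun n => ?_
    by_cases hn : n = k
    · rw [hn, hs'k, norm_neg]
    · rw [hs'n n hn]
  have hxs0 : x + s ≠ 0 := norm_pos_iff.1 (by linarith)
  have hs'0 : s' ≠ 0 := norm_pos_iff.1 (by linarith)
  obtain ⟨φ, hφ, hφxs, h⟩ := hlush.exists_functional_of_ne_zero hxs0 hs'0 hδ0
  have hφxs' : 2 - 4 * δ ≤ RCLike.re (φ x) + RCLike.re (φ s) := by
    rw [map_add, map_add] at hφxs
    have := mul_le_mul_of_nonneg_left hxsn.le (by linarith : 0 ≤ 1 - δ)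
    nlinarith [sq_nonneg δ]
  have hφx1 : RCLike.re (φ x) ≤ 1 := (RCLike.re_le_norm _).trans
    ((φ.le_of_opNorm_le hφ.le x).trans_eq (by rw [hx, one_mul]))
  have hφs1 : RCLike.re (φ s) ≤ 1 := (RCLike.re_le_norm _).trans
    ((φ.le_of_opNorm_le hφ.le s).trans ((one_mul _).trans_le hs))
  refine ⟨φ, hφ, by linarith, ?_⟩
  by_contra! hcon
  obtain ⟨ha, ha'⟩ := hcon
  obtain ⟨κ, hκ, hκa⟩ : ∃ κ : 𝕜, ‖κ‖ = 1 ∧ φ e = (‖φ e‖ : 𝕜) * κ := by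
    obtain ⟨β, hβ, h1⟩ := exists_norm_one_mul_eq_norm (φ e)
    have hβ0 : β ≠ 0 := norm_ne_zero_iff.1 (by rw [hβ]; exact one_ne_zero)
    exact ⟨β⁻¹, by rw [norm_inv, hβ, inv_one], by rw [← h1]; field_simp⟩
  set a := ‖φ e‖ with hadef
  have hre : ∀ z : X, RCLike.re (coord z k * φ e) = a * RCLike.re (κ * coord z k) := fun z => by
    rw [hκa, ← RCLike.re_ofReal_mul]
    ring_nf
  have hineq : ∀ z : X, a * ‖coord z k‖ + ‖φ (Q z)‖ ≤ ‖z‖ := fun z =>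
    hX.norm_apply_add_norm_apply_le hφ.le k z
  have hκle : ∀ z : X, ‖κ * coord z k‖ = ‖coord z k‖ := fun z => by rw [norm_mul, hκ, one_mul]
  have hs_re : 1 - 4 * δ ≤ a * RCLike.re (κ * coord s k) + RCLike.re (φ (Q s)) := by
    rw [← hre, ← map_add, ← hsplit]
    linarith
  have hA1 : RCLike.re (κ * coord s k) ≤ 1 :=
    (RCLike.re_le_norm _).trans ((hκle s).trans_le ((hX.le_ell_infty s k).trans hs))
  have hA : 1 - 6 * ε ^ 2 / 1000 ≤ RCLike.re (κ * coord s k) := by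
    have h1 := hineq s
    have h2 := mul_le_mul_of_nonneg_left hsk (by linarith : 0 ≤ a)
    have h3 := RCLike.re_le_norm (φ (Q s))
    have h4 := mul_le_mul_of_nonneg_right (by linarith : a ≤ 1) hδ0.le
    have h5 : a - 6 * δ ≤ a * RCLike.re (κ * coord s k) := by linarith
    by_contra! hlt
    have h6 := mul_lt_mul_of_pos_left hlt (by linarith : 0 < a)
    have h7 : ε * ε ^ 2 ≤ a * ε ^ 2 := mul_le_mul_of_nonneg_right ha.le (sq_nonneg ε)
    have h8 : ε * ε ^ 2 = 1000 * δ := by rw [hδ]; ring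
    linarith
  have hRs : 1 - 4 * δ - a ≤ RCLike.re (φ (Q s)) := by
    have := mul_le_mul_of_nonneg_left hA1 (by linarith : 0 ≤ a)
    linarith
  -- This functional is about 2 - a at `s'`, almost the largest value allowed on the unit ball by
  -- `hineq`. So -κt_k ≈ 1 and φ(Qt) ≈ 1 - a, whence |φ(Qt) - t_k φ(e)| ≈ 1, while |φ(t)| ≈ 1 as
  -- well.
  obtain ⟨t, ht, hφt, hψ⟩ := h (-(κ • hX.coordL k) + φ.comp Q)
  have hψval : ∀ z : X, RCLike.re ((-(κ • hX.coordL k) + φ.comp Q) z) =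
      -RCLike.re (κ * coord z k) + RCLike.re (φ (Q z)) := fun z => by
    simp
  have hψnorm : ‖-(κ • hX.coordL k) + φ.comp Q‖ ≤ 2 := by
    refine (norm_add_le _ _).trans ?_
    rw [norm_neg, norm_smul, hκ, one_mul]
    have h1 := φ.opNorm_comp_le Q
    rw [hφ, one_mul] at h1
    linarith [hX.norm_coordL_le k, hX.norm_eraseL_le k]
  rw [hψval, hψval, hs'k, hQs', hs'norm, mul_neg, map_neg, neg_neg] at hψ
  have hψt : 2 - a - 13 * ε ^ 2 / 1000 ≤ -RCLike.re (κ * coord t k) + RCLike.re (φ (Q t)) := by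
    by_contra! hlt
    have h1 := mul_lt_mul_of_pos_left hlt (by linarith : 0 < ‖s‖)
    have h2 := mul_le_mul_of_nonneg_left
      (by linarith : ‖-(κ • hX.coordL k) + φ.comp Q‖ + 1 ≤ 3) hδ0.le
    have h3 := mul_le_mul_of_nonneg_right h2 (norm_nonneg s)
    have h4 := mul_le_mul_of_nonneg_right hs
      (by nlinarith : 0 ≤ 2 - a - 10 * ε ^ 2 / 1000)
    have h5 := mul_le_mul_of_nonneg_left hδ2 (norm_nonneg s)
    linarith
  have hpar := parallelogram_law_with_norm 𝕜 (coord t k * φ e) (φ (Q t))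
  rw [← hsplit] at hpar
  simp only [pow_two] at hpar
  refine false_of_parallelogram hε hε' hδ rfl ha.le ha'.le ((hX.le_ell_infty t k).trans ht) ?_
    ((hineq t).trans ht) (RCLike.re_le_norm _) (norm_nonneg _) (norm_nonneg _) ?_ hψt ?_ hφt.le hpar
  · rw [← hκle, ← map_neg]
    exact (RCLike.re_le_norm _).trans_eq (norm_neg _)
  · rw [norm_mul]
    exact mul_le_of_le_one_left (norm_nonneg _) ((hX.le_ell_infty t k).trans ht)
  · rw [mul_neg, ← hre, norm_sub_rev, neg_add_eq_sub, ← map_sub]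
    exact RCLike.re_le_norm _

end Dichotomy

/-! ### Slopes of the norm and the fundamental function. -/

section FundamentalFunction

variable {𝕜 : Type*} [RCLike 𝕜] {X : Type*} [NormedAddCommGroup X] [NormedSpace 𝕜 X]
  {coord : X →ₗ[𝕜] (ℕ → 𝕜)}

/-- In a lush rearrangement invariant space, the norm as a function of a single nonnegative
coordinate has slope zero or one. -/
theorem IsRearrangementInvariant.norm_eraseL_eq_or_norm_add_eq
    (hX : IsRearrangementInvariant coord) (hlush : IsLush 𝕜 X) (a : X) (k : ℕ) {r : ℝ}
    (hr : 0 ≤ r) (hak : coord a k = (r : 𝕜)) :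
    ‖hX.eraseL k a‖ = ‖a‖ ∨
      ∀ s : ℝ, 0 ≤ s → ‖a + (s : 𝕜) • hX.unitVec k‖ = ‖a‖ + s := by
  rcases eq_or_ne a 0 with rfl | ha
  · simp
  by_contra! hcon
  obtain ⟨hne, s, hs, hsne⟩ := hcon
  have h1 : 0 < ‖a‖ - ‖hX.eraseL k a‖ :=
    sub_pos.2 ((hX.norm_eraseL_apply_le k a).lt_of_ne hne)
  have h2 : 0 < ‖a‖ + s - ‖a + (s : 𝕜) • hX.unitVec k‖ := by
    refine sub_pos.2 (lt_of_le_of_ne ((norm_add_le _ _).trans_eq ?_) hsne)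
    rw [norm_smul, hX.norm_unitVec, mul_one, RCLike.norm_ofReal, abs_of_nonneg hs]
  have ha0 : 0 < ‖a‖ := norm_pos_iff.2 ha
  -- One ε below both gaps, since it is not known in advance which alternative for |φ(e_k)| occurs:
  -- a small value contradicts the first gap, a value near 1 the second.
  obtain ⟨ε, hε, hε', hε1, hε2⟩ : ∃ ε : ℝ, 0 < ε ∧ ε ≤ 1 / 2 ∧
      ε * (2 * ‖a‖ + s) < ‖a‖ - ‖hX.eraseL k a‖ ∧
      ε * (2 * ‖a‖ + s) < ‖a‖ + s - ‖a + (s : 𝕜) • hX.unitVec k‖ := by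
    have hc : 0 < 2 * ‖a‖ + s := by positivity
    obtain ⟨ε, hε, hlt⟩ := exists_between (lt_min one_half_pos
      (lt_min (div_pos h1 hc) (div_pos h2 hc)))
    rw [lt_min_iff, lt_min_iff, lt_div_iff₀ hc, lt_div_iff₀ hc] at hlt
    exact ⟨ε, hε, hlt.1.le, hlt.2.1, hlt.2.2⟩
  have hunit : ‖((‖a‖⁻¹ : ℝ) : 𝕜) • a‖ = 1 := by
    rw [norm_smul, RCLike.norm_ofReal, abs_of_nonneg (by positivity), inv_mul_cancel₀ ha0.ne']
  obtain ⟨φ, hφ, hφa, hφk⟩ := hX.exists_functional_dichotomy hlush hunit k hε hε'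
  rw [map_smul, smul_eq_mul, RCLike.re_ofReal_mul, ← div_eq_inv_mul, le_div_iff₀ ha0] at hφa
  have hra : r ≤ ‖a‖ := by
    have := hX.le_ell_infty a k
    rwa [hak, RCLike.norm_ofReal, abs_of_nonneg hr] at this
  have hle : RCLike.re (φ a) ≤ r * ‖φ (hX.unitVec k)‖ + ‖φ (hX.eraseL k a)‖ := by
    refine (RCLike.re_le_norm _).trans ?_
    rw [hX.apply_eq_add_eraseL φ k a]
    refine (norm_add_le _ _).trans_eq ?_
    rw [norm_mul, hak, RCLike.norm_ofReal, abs_of_nonneg hr]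
  rcases hφk with hφk | hφk
  · have h3 := (φ.le_of_opNorm_le hφ.le (hX.eraseL k a)).trans_eq (one_mul _)
    have h4 := mul_le_mul hra hφk (norm_nonneg _) ha0.le
    nlinarith
  · have h3 := hX.norm_apply_add_norm_apply_le hφ.le k (a + (s : 𝕜) • hX.unitVec k)
    have h4 : coord (a + (s : 𝕜) • hX.unitVec k) k = ((r + s : ℝ) : 𝕜) := by
      rw [map_add, map_smul, Pi.add_apply, Pi.smul_apply, hak, hX.coord_unitVec_apply,
        if_pos rfl, smul_eq_mul, mul_one, RCLike.ofReal_add]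
    have h5 : hX.eraseL k (a + (s : 𝕜) • hX.unitVec k) = hX.eraseL k a := by
      refine hX.injective (funext fun n => ?_)
      rw [hX.coord_eraseL, hX.coord_eraseL]
      split_ifs with hn
      · rfl
      · simp [hX.coord_unitVec_apply, hn]
    rw [h4, h5, RCLike.norm_ofReal, abs_of_nonneg (add_nonneg hr hs)] at h3
    have h6 := mul_le_mul_of_nonneg_right hφk hs
    nlinarith

/-- The indicator of a finite set, as an element of a Köthe space. -/
noncomputable def IsKothe.indicatorVec (h : IsKothe coord) (A : Finset ℕ) : X :=
  ∑ i ∈ A, h.unitVec i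

theorem IsKothe.coord_sum_smul_unitVec (h : IsKothe coord) (A : Finset ℕ) (c : ℕ → 𝕜) (n : ℕ) :
    coord (∑ i ∈ A, c i • h.unitVec i) n = if n ∈ A then c n else 0 := by
  rw [map_sum, Finset.sum_apply]
  simp [h.coord_unitVec_apply]

theorem IsKothe.coord_indicatorVec (h : IsKothe coord) (A : Finset ℕ) (n : ℕ) :
    coord (h.indicatorVec A) n = if n ∈ A then 1 else 0 := by
  simpa [IsKothe.indicatorVec] using h.coord_sum_smul_unitVec A 1 n

theorem IsRearrangementInvariant.norm_indicatorVec_le_card (hX : IsRearrangementInvariant coord)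
    (A : Finset ℕ) : ‖hX.indicatorVec A‖ ≤ A.card := by
  refine (norm_sum_le _ _).trans_eq ?_
  simp [hX.norm_unitVec]

/-- The transposition of `m` and `n` carries one set to the other. -/
theorem IsRearrangementInvariant.norm_indicatorVec_erase (hX : IsRearrangementInvariant coord)
    {m n : ℕ} (hm : m ≤ n) :
    ‖hX.indicatorVec ((Finset.range (n + 1)).erase m)‖ = ‖hX.indicatorVec (Finset.range n)‖ := by
  have hsum : Summable fun i => ‖coord (hX.indicatorVec (Finset.range n)) i‖ := by
    refine summable_of_ne_finset_zero (s := Finset.range n) fun i hi => ?_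
    rw [hX.coord_indicatorVec, if_neg hi, norm_zero]
  refine ((hX.perm (Equiv.swap m n) _ hsum).2 _ _ rfl (funext fun i => ?_)).symm
  rw [Function.comp_apply, hX.coord_indicatorVec, hX.coord_indicatorVec, Equiv.symm_swap]
  congr 1
  rw [Finset.mem_erase, Finset.mem_range, Finset.mem_range, Equiv.swap_apply_def]
  split_ifs with h1 h2 <;> simp <;> omega

/-- If the indicator of `A` has the largest possible norm, then the norm dominates the `ℓ₁`-norm of
the coordinates in `A`. -/
theorem IsRearrangementInvariant.sum_norm_coord_le (hX : IsRearrangementInvariant coord)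
    {A : Finset ℕ} (hA : ‖hX.indicatorVec A‖ = A.card) (x : X) :
    ∑ i ∈ A, ‖coord x i‖ ≤ ‖x‖ := by
  -- Fill |x| up to the constant ‖x‖ on `A`: the sum has norm ‖x‖·|A|, and the filling `z` is
  -- bounded by its ℓ₁ norm.
  set y : X := ∑ i ∈ A, (‖coord x i‖ : 𝕜) • hX.unitVec i with hy
  set z : X := ∑ i ∈ A, ((‖x‖ - ‖coord x i‖ : ℝ) : 𝕜) • hX.unitVec i with hz
  have hyx : ‖y‖ ≤ ‖x‖ := by
    refine hX.norm_le_norm fun n => ?_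
    rw [hy, hX.coord_sum_smul_unitVec A fun i => (‖coord x i‖ : 𝕜)]
    split_ifs <;> simp
  have hzle : ‖z‖ ≤ ∑ i ∈ A, (‖x‖ - ‖coord x i‖) := by
    refine (norm_sum_le _ _).trans_eq (Finset.sum_congr rfl fun i _ => ?_)
    rw [norm_smul, hX.norm_unitVec, mul_one, RCLike.norm_ofReal,
      abs_of_nonneg (sub_nonneg.2 (hX.le_ell_infty x i))]
  have hyz : y + z = (‖x‖ : 𝕜) • hX.indicatorVec A := by
    rw [hy, hz, IsKothe.indicatorVec, Finset.smul_sum, ← Finset.sum_add_distrib]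
    refine Finset.sum_congr rfl fun i _ => ?_
    rw [← add_smul]
    push_cast
    ring_nf
  have h := norm_add_le y z
  rw [hyz, norm_smul, hA, RCLike.norm_ofReal, abs_norm] at h
  rw [Finset.sum_sub_distrib, Finset.sum_const, nsmul_eq_mul] at hzle
  linarith

/-- In a lush rearrangement invariant space, the fundamental function is constant on `[n, n + 1]`
unless it takes the largest possible value at `n + 1`. -/
theorem IsRearrangementInvariant.norm_indicatorVec_range_succ
    (hX : IsRearrangementInvariant coord) (hlush : IsLush 𝕜 X) (n : ℕ) :
    ‖hX.indicatorVec (Finset.range (n + 1))‖ = ‖hX.indicatorVec (Finset.range n)‖ ∨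
      ‖hX.indicatorVec (Finset.range (n + 1))‖ = n + 1 := by
  refine or_iff_not_imp_left.2 fun hne => ?_
  set w := hX.indicatorVec (Finset.range (n + 1)) with hw
  have hlt : ‖hX.indicatorVec (Finset.range n)‖ < ‖w‖ := by
    refine lt_of_le_of_ne (hX.norm_le_norm fun i => ?_) (Ne.symm hne)
    rw [hw, hX.coord_indicatorVec, hX.coord_indicatorVec]
    by_cases hi : i < n
    · simp [hi, hi.trans n.lt_succ_self]
    · simp [hi]
  obtain ⟨r, hr, hr1⟩ := exists_between ((div_lt_one ((norm_nonneg _).trans_lt hlt)).2 hlt)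
  have hr0 : 0 ≤ r := le_trans (by positivity) hr.le
  rw [div_lt_iff₀ ((norm_nonneg _).trans_lt hlt)] at hr
  -- A path from `r • w` to `w` raising one coordinate from `r` to 1 at each step. Since ‖1_{[0,n)}‖
  -- < r‖w‖, slope 0 is impossible: erasing a coordinate leaves at most `n` of them, all at most 1.
  obtain ⟨v, hv⟩ : ∃ v : ℕ → X, ∀ m, v m = (r : 𝕜) • w +
      ((1 - r : ℝ) : 𝕜) • hX.indicatorVec (Finset.range m) := ⟨_, fun _ => rfl⟩
  have hcoord : ∀ m i, coord (v m) i = (((if i < n + 1 then r else 0) +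
      (if i < m then 1 - r else 0) : ℝ) : 𝕜) := fun m i => by
    rw [hv, hw, map_add, map_smul, map_smul, Pi.add_apply, Pi.smul_apply, Pi.smul_apply,
      hX.coord_indicatorVec, hX.coord_indicatorVec, RCLike.ofReal_add]
    congr 1
    · simp only [Finset.mem_range]; split_ifs <;> simp
    · simp only [Finset.mem_range]; split_ifs <;> simp
  have hstep : ∀ m ≤ n, ‖v (m + 1)‖ = ‖v m‖ + (1 - r) := by
    intro m hm
    have hvs : v (m + 1) = v m + ((1 - r : ℝ) : 𝕜) • hX.unitVec m := by
      rw [hv, hv, IsKothe.indicatorVec, Finset.sum_range_succ, smul_add, ← add_assoc]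
      rfl
    have hvm : coord (v m) m = (r : 𝕜) := by
      rw [hcoord, if_pos (by omega), if_neg (by omega), add_zero]
    rcases hX.norm_eraseL_eq_or_norm_add_eq hlush (v m) m hr0 hvm with h | h
    · exfalso
      have h1 : ‖hX.eraseL m (v m)‖ ≤ ‖hX.indicatorVec (Finset.range n)‖ := by
        rw [← hX.norm_indicatorVec_erase hm]
        refine hX.norm_le_norm fun i => ?_
        rw [hX.coord_eraseL, hX.coord_indicatorVec, hcoord]
        rcases eq_or_ne i m with rfl | him
        · simp
        · by_cases hi : i < n + 1
          · rw [if_neg him, if_pos (Finset.mem_erase.2 ⟨him, Finset.mem_range.2 hi⟩), norm_one,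
              RCLike.norm_ofReal, if_pos hi, abs_le]
            split_ifs <;> constructor <;> linarith
          · simp [hi, show ¬ i < m by omega]
      have h2 : r * ‖w‖ ≤ ‖v m‖ := by
        have : ‖(r : 𝕜) • w‖ = r * ‖w‖ := by
          rw [norm_smul, RCLike.norm_ofReal, abs_of_nonneg hr0]
        rw [← this]
        refine hX.norm_le_norm fun i => ?_
        rw [hcoord, hw, map_smul, Pi.smul_apply, hX.coord_indicatorVec, RCLike.norm_ofReal]
        by_cases hi : i < n + 1
        · rw [if_pos hi, if_pos (Finset.mem_range.2 hi), smul_eq_mul, mul_one,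
            RCLike.norm_ofReal, abs_of_nonneg hr0]
          refine le_trans ?_ (le_abs_self _)
          split_ifs <;> linarith
        · simp [hi]
      linarith
    · rw [hvs, h _ (by linarith)]
  have hall : ∀ m ≤ n + 1, ‖v m‖ = r * ‖w‖ + m * (1 - r) := by
    intro m
    induction m with
    | zero =>
      intro _
      rw [hv]
      simp [IsKothe.indicatorVec, norm_smul, abs_of_nonneg hr0]
    | succ m ih =>
      intro hm
      rw [hstep m (by omega), ih (by omega)]
      push_cast
      ring
  have hfin := hall (n + 1) le_rfl
  have hvn : v (n + 1) = w := by
    rw [hv, ← hw, ← add_smul, ← RCLike.ofReal_add]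
    simp
  rw [hvn] at hfin
  push_cast at hfin
  have : (1 - r) * (‖w‖ - (n + 1)) = 0 := by linarith
  rcases mul_eq_zero.1 this with h | h <;> linarith

/-- In a lush rearrangement invariant space, the fundamental function cannot grow linearly up to
some `n ≥ 2` and stop growing there. -/
theorem IsRearrangementInvariant.norm_indicatorVec_range_succ_ne
    (hX : IsRearrangementInvariant coord) (hlush : IsLush 𝕜 X) {n : ℕ} (hn : 2 ≤ n)
    (h : ‖hX.indicatorVec (Finset.range n)‖ = n) :
    ‖hX.indicatorVec (Finset.range (n + 1))‖ ≠ n := by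
  intro hw
  set w := hX.indicatorVec (Finset.range (n + 1)) with hwdef
  set e := hX.unitVec 0 with he
  have hn' : (2 : ℝ) ≤ n := by exact_mod_cast hn
  -- Chosen so that a product bounded by κ contradicts the lower bound 1/(4n²) obtained at the end.
  obtain ⟨κ, hκ⟩ : ∃ κ : ℝ, κ = 1 / (8 * (n : ℝ) ^ 2) := ⟨_, rfl⟩
  have hκ0 : 0 < κ := by rw [hκ]; positivity
  have hκn : κ * n * n = 1 / 8 := by rw [hκ]; field_simp
  have hκn' : κ * n ≤ 1 / 16 := by
    have := mul_le_mul_of_nonneg_left hn' (by positivity : 0 ≤ κ * n)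
    linarith
  have hκ1 : κ ≤ 1 / 32 := by
    have := mul_le_mul_of_nonneg_left hn' hκ0.le
    linarith
  -- The factor n + 9 collects n + 7 from ‖σ + χ‖ + 1 and 2 from the estimate of `Re φ(w)`.
  obtain ⟨δ, hδ⟩ : ∃ δ : ℝ, δ = κ / (n + 9) := ⟨_, rfl⟩
  have hδ0 : 0 < δ := by rw [hδ]; positivity
  have hδκ : δ * (n + 9) = κ := by rw [hδ]; field_simp
  have hδle : δ ≤ κ / 11 := by
    have := mul_le_mul_of_nonneg_left (by linarith : (11 : ℝ) ≤ n + 9) hδ0.le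
    linarith
  have hsum : ∀ m ≤ n, ∀ x : X,
      ∑ i ∈ (Finset.range (n + 1)).erase m, ‖coord x i‖ ≤ ‖x‖ := fun m hm x =>
    hX.sum_norm_coord_le (by
      rw [hX.norm_indicatorVec_erase hm, h,
        Finset.card_erase_of_mem (Finset.mem_range.2 (by omega))]
      simp) x
  have hcw : ∀ i, coord w i = if i < n + 1 then 1 else 0 := fun i => by
    simp [hwdef, hX.coord_indicatorVec]
  have hce : ∀ i, coord e i = if i = 0 then 1 else 0 := hX.coord_unitVec_apply 0
  have hx : 2 * (n : ℝ) ≤ ‖w + (n : 𝕜) • e‖ := by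
    refine le_trans (le_of_eq ?_) (hsum n le_rfl _)
    obtain ⟨m, rfl⟩ : ∃ m, n = m + 1 := ⟨n - 1, by omega⟩
    have hval : ∀ i ∈ (Finset.range (m + 1 + 1)).erase (m + 1),
        ‖coord (w + ((m + 1 : ℕ) : 𝕜) • e) i‖ = 1 + if i = 0 then ((m + 1 : ℕ) : ℝ) else 0 := by
      intro i hi
      have hi' : i < m + 1 + 1 := Finset.mem_range.1 (Finset.mem_of_mem_erase hi)
      rw [map_add, map_smul, Pi.add_apply, Pi.smul_apply, hcw, hce, if_pos hi']
      split_ifs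
      · rw [smul_eq_mul, mul_one, ← Nat.cast_one (R := 𝕜), ← Nat.cast_add, RCLike.norm_natCast]
        push_cast
        ring
      · simp
    rw [Finset.sum_congr rfl hval, Finset.sum_add_distrib, Finset.sum_ite_eq' _ 0, if_pos (by simp),
      Finset.sum_const, Finset.card_erase_of_mem (by simp)]
    simp
    ring
  obtain ⟨y, hy⟩ : ∃ y : X, y = w - (2 : 𝕜) • e := ⟨_, rfl⟩
  have hcy : ∀ i, coord y i = if i = 0 then -1 else if i < n + 1 then 1 else 0 := fun i => by
    rw [hy, map_sub, map_smul, Pi.sub_apply, Pi.smul_apply, hcw, hce]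
    split_ifs <;> first | omega | norm_num
  have hynorm : ‖y‖ = n := by
    rw [← hw]
    refine hX.norm_eq_norm fun i => ?_
    rw [hcy, hcw]
    split_ifs <;> first | omega | simp
  have hQy : hX.eraseL 0 y = hX.eraseL 0 w := by
    refine hX.injective (funext fun i => ?_)
    rw [hX.coord_eraseL, hX.coord_eraseL, hcy, hcw]
    split_ifs <;> rfl
  obtain ⟨φ, hφ, hφx, hφy⟩ := hlush.exists_functional_of_ne_zero
    (norm_pos_iff.1 (by linarith : 0 < ‖w + (n : 𝕜) • e‖))
    (norm_pos_iff.1 (by linarith : 0 < ‖y‖)) hδ0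
  have hφle : ∀ z, ‖φ z‖ ≤ ‖z‖ := fun z => (φ.le_of_opNorm_le hφ.le z).trans_eq (one_mul _)
  have hφx' : 2 * n - 2 * n * δ ≤ RCLike.re (φ w) + n * RCLike.re (φ e) := by
    have h1 : RCLike.re (φ (w + (n : 𝕜) • e)) = RCLike.re (φ w) + n * RCLike.re (φ e) := by
      rw [map_add, map_add, map_smul, smul_eq_mul, ← RCLike.ofReal_natCast, RCLike.re_ofReal_mul]
    rw [h1] at hφx
    have h2 := mul_le_mul_of_nonneg_left hx (by linarith : 0 ≤ 1 - δ)
    linarith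
  have hφw1 : RCLike.re (φ w) ≤ n := (RCLike.re_le_norm _).trans ((hφle w).trans_eq hw)
  have hφe1 : ‖φ e‖ ≤ 1 := (hφle e).trans_eq (hX.norm_unitVec 0)
  have hφe1' := (RCLike.re_le_norm (φ e)).trans hφe1
  have hφw : n - 2 * n * δ ≤ RCLike.re (φ w) := by
    have := mul_le_mul_of_nonneg_left hφe1' (by linarith : (0 : ℝ) ≤ n)
    linarith
  have hφe : 1 - 2 * δ ≤ ‖φ e‖ := by
    refine le_trans ?_ (RCLike.re_le_norm _)
    have : n * (1 - 2 * δ) ≤ n * RCLike.re (φ e) := by linarith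
    exact le_of_mul_le_mul_left this (by linarith)
  -- σ sums the coordinates with the signs of `y`; χ is φ with its 0-th coefficient negated. On the
  -- unit ball Re σ ≤ (n+1)/n and |χ| ≤ 1, and `y`/n almost attains both bounds.
  obtain ⟨σ, hσ⟩ : ∃ σ : X →L[𝕜] 𝕜, σ = ∑ i ∈ Finset.range (n + 1), hX.coordL i -
    (2 : 𝕜) • hX.coordL 0 := ⟨_, rfl⟩
  obtain ⟨χ, hχ⟩ : ∃ χ : X →L[𝕜] 𝕜, χ = (2 : 𝕜) • φ.comp (hX.eraseL 0) - φ := ⟨_, rfl⟩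
  have hσnorm : ‖σ‖ ≤ n + 3 := by
    rw [hσ]
    refine (norm_sub_le _ _).trans ?_
    have h1 : ‖∑ i ∈ Finset.range (n + 1), hX.coordL i‖ ≤ n + 1 :=
      (norm_sum_le_of_le _ fun i _ => hX.norm_coordL_le i).trans_eq (by simp)
    have h2 := hX.norm_coordL_le 0
    rw [norm_smul, RCLike.norm_ofNat]
    linarith
  have hχnorm : ‖χ‖ ≤ 3 := by
    rw [hχ]
    refine (norm_sub_le _ _).trans ?_
    have h1 := φ.opNorm_comp_le (hX.eraseL 0)
    have h2 := hX.norm_eraseL_le 0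
    rw [hφ, one_mul] at h1
    rw [norm_smul, RCLike.norm_ofNat, hφ]
    linarith
  have hχapply : ∀ z, χ z = φ (hX.eraseL 0 z) - coord z 0 * φ e := fun z => by
    have := hX.apply_eq_add_eraseL φ 0 z
    simp only [hχ, sub_apply, smul_apply,
      ContinuousLinearMap.comp_apply, smul_eq_mul, this, he]
    ring
  have hσapply : ∀ z, RCLike.re (σ z) =
      ∑ i ∈ Finset.range (n + 1), RCLike.re (coord z i) - 2 * RCLike.re (coord z 0) := fun z => by
    have h2 : (2 : 𝕜) = ((2 : ℝ) : 𝕜) :=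
      (map_ofNat (algebraMap ℝ 𝕜) 2).symm
    simp only [hσ, sub_apply, smul_apply,
      sum_apply, smul_eq_mul, map_sub, map_sum, hX.coordL_apply]
    rw [h2, RCLike.re_ofReal_mul]
  have hσle : ∀ z, RCLike.re (σ z) ≤ ∑ i ∈ Finset.range (n + 1), ‖coord z i‖ := fun z => by
    rw [hσapply, Finset.sum_range_succ', Finset.sum_range_succ']
    have h1 := Finset.sum_le_sum fun i (_ : i ∈ Finset.range n) =>
      RCLike.re_le_norm (coord z (i + 1))
    have h2 := RCLike.re_le_norm (-coord z 0)
    rw [map_neg, norm_neg] at h2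
    linarith
  have hσy : RCLike.re (σ y) = n + 1 := by
    rw [hσapply, Finset.sum_range_succ', Finset.sum_congr rfl (g := fun _ => (1 : ℝ))]
    · simp [hcy]
      ring
    · intro i hi
      have : i < n := Finset.mem_range.1 hi
      simp [hcy, this]
  have hχy : χ y = φ w := by
    rw [hχapply, hQy, hX.apply_eq_add_eraseL φ 0 w, hcy, hcw, if_pos rfl, if_pos (by omega)]
    ring
  obtain ⟨t, ht, hφt, hψ⟩ := hφy (σ + χ)
  rw [add_apply, add_apply, map_add, map_add, hσy, hχy,
    hynorm] at hψ
  have hψ' : 2 * n + 1 - n * κ ≤ n * RCLike.re (σ t) + n * RCLike.re (χ t) := by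
    have h1 : ‖σ + χ‖ + 1 ≤ n + 7 := by linarith [norm_add_le σ χ]
    have h2 := mul_le_mul_of_nonneg_left h1 (by positivity : 0 ≤ δ * n)
    rw [← hδκ]
    linarith
  set S := ∑ i ∈ Finset.range (n + 1), ‖coord t i‖ with hS
  have hSk : ∀ m ≤ n, S - ‖coord t m‖ ≤ 1 := fun m hm => by
    have h1 := (hsum m hm t).trans ht
    rw [← Finset.add_sum_erase _ _ (Finset.mem_range.2 (by omega : m < n + 1))] at hS
    linarith
  -- Add the n + 1 inequalities `hSk`.
  have hnS : n * S ≤ n + 1 := by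
    have h1 := Finset.sum_le_sum fun i (hi : i ∈ Finset.range (n + 1)) =>
      hSk i (by have := Finset.mem_range.1 hi; omega)
    rw [Finset.sum_sub_distrib, ← hS] at h1
    simp at h1
    linarith
  have hsplit := hX.apply_eq_add_eraseL φ 0 t
  have hineq := (hX.norm_apply_add_norm_apply_le hφ.le 0 t).trans ht
  have hpar := parallelogram_law_with_norm 𝕜 (coord t 0 * φ e) (φ (hX.eraseL 0 t))
  rw [← hsplit, norm_sub_rev, ← hχapply] at hpar
  have hp : ‖coord t 0 * φ e‖ = ‖coord t 0‖ * ‖φ e‖ := norm_mul _ _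
  rw [hp] at hpar
  rw [← he, mul_comm ‖φ e‖] at hineq
  have hφt' : ‖φ t‖ ≤ ‖coord t 0‖ * ‖φ e‖ + ‖φ (hX.eraseL 0 t)‖ := by
    rw [hsplit, ← hp]
    exact norm_add_le _ _
  have hχt1 : ‖χ t‖ ≤ 1 := by
    rw [hχapply]
    refine (norm_sub_le _ _).trans ?_
    rw [hp]
    linarith
  have hnσ := mul_le_mul_of_nonneg_left (hσle t) (by linarith : (0 : ℝ) ≤ n)
  have hχt : 1 - κ ≤ ‖χ t‖ := by
    refine le_trans ?_ (RCLike.re_le_norm _)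
    have : n * (1 - κ) ≤ n * RCLike.re (χ t) := by linarith
    exact le_of_mul_le_mul_left this (by linarith)
  -- Near equality in the bounds for σ and χ gives nS ≥ n + 1 - nκ, so no |t_m| can be much smaller
  -- than 1/n.
  have hlow : ∀ m ≤ n, 1 - n * κ ≤ n * ‖coord t m‖ := fun m hm => by
    have h1 := mul_le_mul_of_nonneg_left (hSk m hm) (by linarith : (0 : ℝ) ≤ n)
    have h2 := mul_le_mul_of_nonneg_left ((RCLike.re_le_norm _).trans hχt1)
      (by linarith : (0 : ℝ) ≤ n)
    linarith
  have hlow0 := hlow 0 (by omega)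
  have hlow1 := hlow 1 (by omega)
  -- Here n ≥ 2 is essential: both indices survive the removal of index n. It keeps |φ(Qt)| of order
  -- at least 1/n in `hB`.
  have h01 : ‖coord t 0‖ + ‖coord t 1‖ ≤ 1 := by
    refine le_trans ?_ ((hsum n le_rfl t).trans ht)
    rw [← Finset.sum_pair (f := fun i => ‖coord t i‖) zero_ne_one]
    refine Finset.sum_le_sum_of_subset_of_nonneg (fun i hi => ?_) fun _ _ _ => norm_nonneg _
    simp at hi ⊢
    omega
  have hnδ : n * δ ≤ 1 / 16 := by
    have := mul_le_mul_of_nonneg_left hδle (by linarith : (0 : ℝ) ≤ n)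
    linarith
  have hA : 1 / 2 ≤ n * (‖coord t 0‖ * ‖φ e‖) := by
    have h1 := mul_le_mul hlow0 hφe (by linarith) (by positivity)
    have h2 := mul_le_mul_of_nonneg_right (by linarith : 15 / 16 ≤ 1 - n * κ)
      (by linarith : 0 ≤ 1 - 2 * δ)
    linarith
  have hB : 1 / 2 ≤ n * ‖φ (hX.eraseL 0 t)‖ := by
    have h1 := mul_le_mul_of_nonneg_left hφe1 (norm_nonneg (coord t 0))
    have h2 := mul_le_mul_of_nonneg_left
      (by linarith : 1 - δ - ‖coord t 0‖ ≤ ‖φ (hX.eraseL 0 t)‖) (by linarith : (0 : ℝ) ≤ n)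
    have h3 := mul_le_mul_of_nonneg_left h01 (by linarith : (0 : ℝ) ≤ n)
    linarith
  have hAB := mul_le_mul hA hB (by norm_num) (by positivity)
  have hs2 := pow_le_pow_left₀ (by linarith : 0 ≤ 1 - δ) hφt.le 2
  have hD2 := pow_le_pow_left₀ (by linarith : 0 ≤ 1 - κ) hχt 2
  have hle2 := pow_le_pow_left₀ (by positivity) hineq 2
  have hprod : ‖coord t 0‖ * ‖φ e‖ * ‖φ (hX.eraseL 0 t)‖ ≤ κ := by
    nlinarith only [hs2, hD2, hle2, hpar, hδle, hκ0, sq_nonneg δ, sq_nonneg κ]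
  have := mul_le_mul_of_nonneg_right hprod (by positivity : (0 : ℝ) ≤ n * n)
  linarith

end FundamentalFunction

/-! ### Identification with `c₀` or `ℓ₁`. -/

section Identification

open Filter Topology

variable {𝕜 : Type*} [RCLike 𝕜] {X : Type*} [NormedAddCommGroup X] [NormedSpace 𝕜 X]
  {coord : X →ₗ[𝕜] (ℕ → 𝕜)}

/-- In a lush rearrangement invariant space, the fundamental function is that of `ℓ₁` or bounded by
that of `c₀`. -/
theorem IsRearrangementInvariant.norm_indicatorVec_range_eq_or_le
    (hX : IsRearrangementInvariant coord) (hlush : IsLush 𝕜 X) :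
    (∀ n : ℕ, ‖hX.indicatorVec (Finset.range n)‖ = n) ∨
      ∀ n : ℕ, ‖hX.indicatorVec (Finset.range n)‖ ≤ 1 := by
  have h0 : ‖hX.indicatorVec (Finset.range 0)‖ = 0 := by simp [IsKothe.indicatorVec]
  have h1 : ‖hX.indicatorVec (Finset.range 1)‖ = 1 := by
    simp [IsKothe.indicatorVec, hX.norm_unitVec]
  refine or_iff_not_imp_left.2 fun hne => ?_
  have h2 : ‖hX.indicatorVec (Finset.range 2)‖ = 1 := by
    by_contra h2
    refine hne fun n => ?_
    induction n with
    | zero => simpa using h0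
    | succ n ih =>
      rcases hX.norm_indicatorVec_range_succ hlush n with h | h
      · exfalso
        rcases Nat.lt_or_ge n 2 with hn | hn
        · interval_cases n
          · rw [h0, h1] at h
            exact one_ne_zero h
          · exact h2 (h.trans h1)
        · exact hX.norm_indicatorVec_range_succ_ne hlush hn ih (h.trans ih)
      · simpa using h
  intro n
  induction n with
  | zero => rw [h0]; exact zero_le_one
  | succ n ih =>
    rcases hX.norm_indicatorVec_range_succ hlush n with h | h
    · rwa [h]
    · rcases Nat.eq_zero_or_pos n with rfl | hn
      · exact h1.le
      · exfalso
        -- A late jump to n + 1 would make the norm dominate the ℓ₁ norm on [0, n], against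
        -- ‖1_{[0,2)}‖ = 1.
        have h3 := hX.sum_norm_coord_le (A := Finset.range (n + 1)) (by simpa using h)
          (hX.indicatorVec (Finset.range 2))
        have h4 : ∑ i ∈ Finset.range 2, ‖coord (hX.indicatorVec (Finset.range 2)) i‖ = 2 := by
          simp [hX.coord_indicatorVec, Finset.sum_range_succ]
          norm_num
        have h5 := Finset.sum_le_sum_of_subset_of_nonneg
          (f := fun i => ‖coord (hX.indicatorVec (Finset.range 2)) i‖)
          (Finset.range_mono (by omega : 2 ≤ n + 1)) fun _ _ _ => norm_nonneg _
        linarith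

/-- The elements of a separable rearrangement invariant space are null sequences. -/
theorem IsRearrangementInvariant.tendsto_coord [TopologicalSpace.SeparableSpace X]
    (hX : IsRearrangementInvariant coord) (x : X) : Tendsto (coord x) atTop (𝓝 0) := by
  by_contra hcon
  rw [tendsto_zero_iff_norm_tendsto_zero, Metric.tendsto_nhds] at hcon
  push Not at hcon
  obtain ⟨ε, hε, hfreq⟩ := hcon
  obtain ⟨u, hu, hεu⟩ := extraction_of_frequently_atTop hfreq
  obtain ⟨d, hd⟩ := TopologicalSpace.exists_dense_seq X
  classical
  -- Diagonal argument: `f` is ε or 0 at `u k`, whichever is at least ε/2 away from the `k`-th term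
  -- of the dense sequence. Solidity puts `f` in the space.
  obtain ⟨f, hf⟩ : ∃ f : ℕ → 𝕜, ∀ n, f n =
      if ∃ k, u k = n ∧ ‖coord (d k) n‖ < ε / 2 then (ε : 𝕜) else 0 := ⟨_, fun _ => rfl⟩
  obtain ⟨y, hy, -⟩ := hX.solid f x fun n => by
    rw [hf]
    split_ifs with h
    · obtain ⟨k, rfl, -⟩ := h
      rw [RCLike.norm_ofReal, abs_of_pos hε]
      simpa using hεu k
    · simp
  obtain ⟨k, hk⟩ := hd.exists_dist_lt y (half_pos hε)
  have hlt : ‖coord y (u k) - coord (d k) (u k)‖ < ε / 2 := by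
    have := hX.le_ell_infty (y - d k) (u k)
    rw [map_sub] at this
    exact this.trans_lt (by rwa [← dist_eq_norm])
  rw [hy, hf] at hlt
  split_ifs at hlt with h
  · obtain ⟨j, hj, hjlt⟩ := h
    obtain rfl := hu.injective hj
    have h1 := norm_sub_norm_le (ε : 𝕜) (coord (d j) (u j))
    rw [RCLike.norm_ofReal, abs_of_pos hε] at h1
    linarith
  · refine h ⟨k, rfl, ?_⟩
    rwa [zero_sub, norm_neg] at hlt

/-- If the fundamental function is bounded by one, then every null sequence belongs to the space,
with norm at most its supremum norm. -/
theorem IsRearrangementInvariant.exists_coord_eq_of_tendsto [CompleteSpace X]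
    (hX : IsRearrangementInvariant coord)
    (h : ∀ n : ℕ, ‖hX.indicatorVec (Finset.range n)‖ ≤ 1) {g : ℕ → 𝕜}
    (hg : Tendsto g atTop (𝓝 0)) :
    ∃ z : X, coord z = g ∧ ∀ M : ℝ, (∀ n, ‖g n‖ ≤ M) → ‖z‖ ≤ M := by
  -- Finite blocks are dominated by multiples of indicators. Tails give the Cauchy property; the
  -- block from 0 gives the norm bound.
  have hfin : ∀ (M : ℝ) (m n : ℕ), 0 ≤ M → (∀ i, m ≤ i → ‖g i‖ ≤ M) →
      ‖∑ i ∈ Finset.Ico m n, g i • hX.unitVec i‖ ≤ M := by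
    intro M m n hM hgM
    have h1 : ‖(M : 𝕜) • hX.indicatorVec (Finset.range n)‖ ≤ M := by
      rw [norm_smul, RCLike.norm_ofReal, abs_of_nonneg hM]
      exact mul_le_of_le_one_right hM (h n)
    refine (hX.norm_le_norm fun i => ?_).trans h1
    rw [hX.coord_sum_smul_unitVec, map_smul, Pi.smul_apply, hX.coord_indicatorVec]
    split_ifs with h2 h3 h3
    · rw [smul_eq_mul, mul_one, RCLike.norm_ofReal]
      exact (hgM i (Finset.mem_Ico.1 h2).1).trans (le_abs_self M)
    · exact absurd (Finset.mem_range.2 (Finset.mem_Ico.1 h2).2) h3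
    · simp
    · simp
  have hcauchy : CauchySeq fun n => ∑ i ∈ Finset.range n, g i • hX.unitVec i := by
    refine Metric.cauchySeq_iff'.2 fun ε hε => ?_
    obtain ⟨N, hN⟩ := Metric.tendsto_atTop.1 hg (ε / 2) (half_pos hε)
    refine ⟨N, fun n hn => ?_⟩
    rw [dist_eq_norm, ← Finset.sum_Ico_eq_sub _ hn]
    refine (hfin (ε / 2) N n (half_pos hε).le fun i hi => ?_).trans_lt (half_lt_self hε)
    simpa using (hN i hi).le
  obtain ⟨z, hz⟩ := cauchySeq_tendsto_of_complete hcauchy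
  refine ⟨z, funext fun k => ?_, fun M hM => ?_⟩
  · refine tendsto_nhds_unique (((hX.coordL k).continuous.tendsto z).comp hz) ?_
    refine tendsto_const_nhds.congr' ?_
    filter_upwards [eventually_gt_atTop k] with n hn
    rw [Function.comp_apply, hX.coordL_apply, hX.coord_sum_smul_unitVec,
      if_pos (Finset.mem_range.2 hn)]
  · refine le_of_tendsto hz.norm (Eventually.of_forall fun n => ?_)
    rw [Finset.range_eq_Ico]
    exact hfin M 0 n ((norm_nonneg _).trans (hM 0)) fun i _ => hM i

/-- A separable rearrangement invariant space whose fundamental function is bounded by one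
is `c₀`. -/
theorem IsRearrangementInvariant.exists_linearIsometryEquiv_zeroAtInfty [CompleteSpace X]
    [TopologicalSpace.SeparableSpace X] (hX : IsRearrangementInvariant coord)
    (h : ∀ n : ℕ, ‖hX.indicatorVec (Finset.range n)‖ ≤ 1) :
    ∃ e : X ≃ₗᵢ[𝕜] C₀(ℕ, 𝕜), ∀ (x : X) (n : ℕ), e x n = coord x n := by
  have hzero : ∀ x : X, Tendsto (coord x) (cocompact ℕ) (𝓝 0) := fun x => by
    rw [cocompact_eq_cofinite, Nat.cofinite_eq_atTop]
    exact hX.tendsto_coord x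
  let T : X →ₗ[𝕜] C₀(ℕ, 𝕜) :=
    { toFun := fun x => ⟨⟨coord x, continuous_of_discreteTopology⟩, hzero x⟩
      map_add' := fun x y => by ext n; simp
      map_smul' := fun c x => by ext n; simp }
  have hnorm : ∀ x, ‖T x‖ = ‖x‖ := fun x => by
    refine le_antisymm ?_ ?_
    · rw [← ZeroAtInftyContinuousMap.norm_toBCF_eq_norm,
        BoundedContinuousFunction.norm_le (norm_nonneg x)]
      exact fun n => hX.le_ell_infty x n
    · obtain ⟨z, hz, hzle⟩ := hX.exists_coord_eq_of_tendsto h (hX.tendsto_coord x)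
      rw [← hX.injective hz]
      refine hzle _ fun n => ?_
      rw [← ZeroAtInftyContinuousMap.norm_toBCF_eq_norm, hX.injective hz]
      exact (T x).toBCF.norm_coe_le_norm n
  let L : X →ₗᵢ[𝕜] C₀(ℕ, 𝕜) := ⟨T, hnorm⟩
  have hsurj : Function.Surjective L := fun g => by
    have hg : Tendsto g atTop (𝓝 0) := by
      rw [← Nat.cofinite_eq_atTop, ← cocompact_eq_cofinite]
      exact zero_at_infty g
    obtain ⟨z, hz, -⟩ := hX.exists_coord_eq_of_tendsto h hg
    exact ⟨z, by ext n; exact congrFun hz n⟩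
  exact ⟨LinearIsometryEquiv.ofSurjective L hsurj, fun _ _ => rfl⟩

/-- A rearrangement invariant space whose fundamental function is the largest possible one
is `ℓ₁`. -/
theorem IsRearrangementInvariant.exists_linearIsometryEquiv_lp_one
    (hX : IsRearrangementInvariant coord)
    (h : ∀ n : ℕ, ‖hX.indicatorVec (Finset.range n)‖ = n) :
    ∃ e : X ≃ₗᵢ[𝕜] lp (fun _ : ℕ => 𝕜) 1, ∀ (x : X) (n : ℕ), e x n = coord x n := by
  have hle : ∀ (x : X) (n : ℕ), ∑ i ∈ Finset.range n, ‖coord x i‖ ≤ ‖x‖ := fun x n =>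
    hX.sum_norm_coord_le (by simpa using h n) x
  have hsum : ∀ x : X, Summable fun n => ‖coord x n‖ := fun x =>
    summable_of_sum_range_le (fun _ => norm_nonneg _) (hle x)
  have hmem : ∀ f : ℕ → 𝕜, Memℓp f 1 ↔ Summable fun n => ‖f n‖ := fun f => by
    rw [memℓp_gen_iff (by simp)]
    simp
  let T : X →ₗ[𝕜] lp (fun _ : ℕ => 𝕜) 1 :=
    { toFun := fun x => ⟨coord x, (hmem _).2 (hsum x)⟩
      map_add' := fun x y => by ext n; exact congrFun (map_add coord x y) n
      map_smul' := fun c x => by ext n; exact congrFun (map_smul coord c x) n }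
  have hT : ∀ x n, T x n = coord x n := fun _ _ => rfl
  have hnorm : ∀ x, ‖T x‖ = ‖x‖ := fun x => by
    have h1 : ‖T x‖ = ∑' n, ‖coord x n‖ := by
      rw [lp.norm_eq_tsum_rpow (by simp)]
      simp [hT]
    rw [h1]
    refine le_antisymm (Real.tsum_le_of_sum_range_le (fun _ => norm_nonneg _) (hle x)) ?_
    obtain ⟨z, hz, hzle⟩ := hX.ell_one_le (coord x) (hsum x)
    rwa [hX.injective hz] at hzle
  let L : X →ₗᵢ[𝕜] lp (fun _ : ℕ => 𝕜) 1 := ⟨T, hnorm⟩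
  have hsurj : Function.Surjective L := fun g => by
    obtain ⟨z, hz, -⟩ := hX.ell_one_le g ((hmem g).1 g.2)
    exact ⟨z, by ext n; exact congrFun hz n⟩
  exact ⟨LinearIsometryEquiv.ofSurjective L hsurj, fun _ _ => rfl⟩

end Identification

/-- A separable lush rearrangement invariant space `X` on `ℕ` is `c₀` or `ℓ₁`: the identity
on sequences is a surjective linear isometry of `X` onto `c₀` or onto `ℓ₁`. -/
theorem mainTheorem6 {𝕜 : Type*} [RCLike 𝕜] {X : Type*} [NormedAddCommGroup X]
    [NormedSpace 𝕜 X] [CompleteSpace X] [TopologicalSpace.SeparableSpace X]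
    (coord : X →ₗ[𝕜] (ℕ → 𝕜)) (hX : IsRearrangementInvariant coord) (hlush : IsLush 𝕜 X) :
    (∃ e : X ≃ₗᵢ[𝕜] C₀(ℕ, 𝕜), ∀ (x : X) (n : ℕ), e x n = coord x n) ∨
      (∃ e : X ≃ₗᵢ[𝕜] lp (fun _ : ℕ => 𝕜) 1, ∀ (x : X) (n : ℕ), e x n = coord x n) := by
  rcases hX.norm_indicatorVec_range_eq_or_le hlush with h | h
  · exact Or.inr (hX.exists_linearIsometryEquiv_lp_one h)
  · exact Or.inl (hX.exists_linearIsometryEquiv_zeroAtInfty h)
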